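/- Let $k$ be a field and write $\otimes=\otimes_k$. Let $(H,\Delta)$ be a Hopf $k$-algebra with invariant functionals, i.e. there exist non-zero linear functionals $\varphi,\psi_H\colon H\to k$ with $(\mathrm{id}\otimes\varphi)\Delta(h)=\varphi(h)1$ and $(\psi_H\otimes\mathrm{id})\Delta(h)=\psi_H(h)1$ for all $h\in H$. Let $I$ be a set and let $(A,\alpha)$ be an $I$-Galois object for $H$. That is, $A$ is an associative, not necessarily unital $k$-algebra; $\alpha\colon A\to A\otimes H$ is an algebra homomorphism making $A$ a (coassociative, counital) right $H$-comodule; with $A^\alpha=\{a\in A\mid \alpha(a)=a\otimes 1\}$, the Galois map $$A\otimes_{A^\alpha}A\to A\otimes H,\qquad a\otimes b\mapsto (a\otimes 1)\alpha(b)$$ is bijective; and there is given an isomorphism of $k$-algebras $A^\alpha\cong k_I$, where $k_I=\bigoplus_{i\in I}k$ is the algebra of finitely supported functions $I\to k$ with pointwise operations. Let $p_i\in A^\alpha$ $(i\in I)$ be the idempotent corresponding to the indicator function of $\{i\}$. A linear functional $\psi\colon A\to k$ is called invariant if $(\psi\otimes\mathrm{id})\alpha(x)=\psi(x)1_H$ for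 all $x\in A$, and left complete if for every $i\in I$ the functional $a\mapsto\psi(p_ia)$ is non-zero. For $i,j\in I$ put $\psi_{ij}\colon A\to k$, $\psi_{ij}(a)=\psi(p_iap_j)$. **Theorem.** Let $\psi_A$ be a left complete invariant functional on $A$, with components $\psi_{ij}(a)=\psi_A(p_iap_j)$. Then there exists a bijection $\mu\colon I\to I$ such that, for all $i,j\in I$, $\psi_{ij}\neq 0$ if and only if $j=\mu(i)$. Moreover, for every invariant functional $\widetilde\psi$ on $A$ there exist scalars $c_i\in k$ $(i\in I)$ such that $$\widetilde\psi_{ij}=\delta_{j,\mu(i)}\,c_i\,\psi_{ij}\qquad\text{for all } i,j\in I.$$ -/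

import Mathlib

open scoped TensorProduct

namespace GaloisCoaction

/-- A Hopf algebra has invariant functionals if it admits a nonzero left invariant functional `φ`,
`(id ⊗ φ) Δ(h) = φ(h) 1`, and a nonzero right invariant functional `ψ`,
`(ψ ⊗ id) Δ(h) = ψ(h) 1`. -/
def HasInvariantFunctionals (k H : Type*) [Field k] [Ring H] [HopfAlgebra k H] : Prop :=
  (∃ φ : H →ₗ[k] k, φ ≠ 0 ∧
    ∀ h : H, TensorProduct.rid k H (φ.lTensor H (Coalgebra.comul (R := k) h)) = φ h • (1 : H)) ∧
  (∃ ψ : H →ₗ[k] k, ψ ≠ 0 ∧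
    ∀ h : H, TensorProduct.lid k H (ψ.rTensor H (Coalgebra.comul (R := k) h)) = ψ h • (1 : H))

/-- A (right) `H`-comodule algebra structure on a not necessarily unital `k`-algebra `A`:
an algebra homomorphism `α : A → A ⊗ H` which is coassociative and counital. -/
structure Coaction (k H A : Type*) [Field k] [Ring H] [HopfAlgebra k H]
    [NonUnitalRing A] [Module k A] [IsScalarTower k A A] [SMulCommClass k A A] where
  /-- The coaction map. -/
  map : A →ₙₐ[k] A ⊗[k] H
  /-- `(α ⊗ id) α = (id ⊗ Δ) α`. -/
  coassoc : ∀ a : A,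
    TensorProduct.assoc k A H H ((map : A →ₗ[k] A ⊗[k] H).rTensor H (map a)) =
      (Coalgebra.comul (R := k) (A := H)).lTensor A (map a)
  /-- `(id ⊗ ε) α = id`. -/
  counit : ∀ a : A,
    TensorProduct.rid k A ((Coalgebra.counit (R := k) (A := H)).lTensor A (map a)) = a

section

variable {k H A : Type*} [Field k] [Ring H] [HopfAlgebra k H]
  [NonUnitalRing A] [Module k A] [IsScalarTower k A A] [SMulCommClass k A A]

/-- The algebra of coinvariants `A^α = {a | α(a) = a ⊗ 1}`. -/
def Coaction.coinvariants (α : Coaction k H A) : NonUnitalSubalgebra k A where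
  carrier := {a | α.map a = a ⊗ₜ[k] (1 : H)}
  add_mem' {a b} ha hb := by
    change α.map a = _ at ha
    change α.map b = _ at hb
    change α.map (a + b) = _
    rw [map_add, ha, hb, TensorProduct.add_tmul]
  zero_mem' := by
    change α.map 0 = _
    simp
  mul_mem' {a b} ha hb := by
    change α.map a = _ at ha
    change α.map b = _ at hb
    change α.map (a * b) = _
    rw [map_mul, ha, hb, Algebra.TensorProduct.tmul_mul_tmul, mul_one]
  smul_mem' c a ha := by
    change α.map a = _ at ha
    change α.map (c • a) = _
    rw [map_smul, ha, TensorProduct.smul_tmul']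

/-- The subspace of `A ⊗ A` spanned by the elements `ab ⊗ c - a ⊗ bc` with `b ∈ B`. -/
def balancing (B : NonUnitalSubalgebra k A) : Submodule k (A ⊗[k] A) :=
  Submodule.span k {t | ∃ a : A, ∃ b ∈ B, ∃ c : A,
    t = (a * b) ⊗ₜ[k] c - a ⊗ₜ[k] (b * c)}

/-- The tensor product `A ⊗_B A` over a (not necessarily unital) subalgebra `B`. -/
abbrev BalancedTensor (B : NonUnitalSubalgebra k A) : Type _ :=
  (A ⊗[k] A) ⧸ balancing B

/-- The linear map `A ⊗ A → A ⊗ H`, `a ⊗ b ↦ (a ⊗ 1) α(b)`, before passing to `A ⊗_{A^α} A`. -/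
noncomputable def Coaction.preGaloisMap (α : Coaction k H A) : A ⊗[k] A →ₗ[k] A ⊗[k] H :=
  TensorProduct.lift
    ((LinearMap.mul k (A ⊗[k] H)).compl₁₂ ((TensorProduct.mk k A H).flip 1)
      (α.map : A →ₗ[k] A ⊗[k] H))

theorem Coaction.preGaloisMap_tmul (α : Coaction k H A) (a b : A) :
    α.preGaloisMap (a ⊗ₜ[k] b) = (a ⊗ₜ[k] (1 : H)) * α.map b := by
  simp [Coaction.preGaloisMap]

theorem Coaction.balancing_le_ker (α : Coaction k H A) :
    balancing α.coinvariants ≤ LinearMap.ker α.preGaloisMap := by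
  refine Submodule.span_le.2 ?_
  rintro _ ⟨a, b, hb, c, rfl⟩
  have hb' : α.map b = b ⊗ₜ[k] (1 : H) := hb
  simp only [SetLike.mem_coe, LinearMap.mem_ker, map_sub, Coaction.preGaloisMap_tmul, map_mul]
  rw [hb', ← mul_assoc, Algebra.TensorProduct.tmul_mul_tmul, mul_one, sub_self]

/-- The Galois map `A ⊗_{A^α} A → A ⊗ H`, `a ⊗ b ↦ (a ⊗ 1) α(b)`. -/
noncomputable def Coaction.galoisMap (α : Coaction k H A) :
    BalancedTensor α.coinvariants →ₗ[k] A ⊗[k] H :=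
  (balancing α.coinvariants).liftQ α.preGaloisMap α.balancing_le_ker

/-- The coaction is Galois if the Galois map is an isomorphism. -/
def Coaction.IsGalois (α : Coaction k H A) : Prop := Function.Bijective α.galoisMap

/-- A functional `ψ` on `A` is invariant if `(ψ ⊗ id) α(x) = ψ(x) 1` for all `x`. -/
def Coaction.IsInvariant (α : Coaction k H A) (ψ : A →ₗ[k] k) : Prop :=
  ∀ x : A, TensorProduct.lid k H (ψ.rTensor H (α.map x)) = ψ x • (1 : H)

end

/-- An `I`-Galois object: a Galois coaction together with an isomorphism of `k`-algebras
`k_I ≅ A^α`, where `k_I` is the direct sum of copies of `k` indexed by `I` (the finitely supported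
functions `I → k` with pointwise operations). -/
structure GaloisObject (k H A I : Type*) [Field k] [Ring H] [HopfAlgebra k H]
    [NonUnitalRing A] [Module k A] [IsScalarTower k A A] [SMulCommClass k A A]
    extends Coaction k H A where
  isGalois : toCoaction.IsGalois
  /-- The identification of `k_I` with the coinvariants. -/
  iso : (I →₀ k) →ₙₐ[k] toCoaction.coinvariants
  iso_bijective : Function.Bijective iso

namespace GaloisObject

variable {k H A I : Type*} [Field k] [Ring H] [HopfAlgebra k H]
  [NonUnitalRing A] [Module k A] [IsScalarTower k A A] [SMulCommClass k A A]

/-- The minimal idempotents `p_i` of `A^α ≅ k_I`, seen as elements of `A`. -/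
noncomputable def p (G : GaloisObject k H A I) (i : I) : A :=
  (G.iso (Finsupp.single i 1) : A)

/-- `ψ_{i-} = ψ(p_i · )`. -/
noncomputable def leftComponent (G : GaloisObject k H A I) (ψ : A →ₗ[k] k) (i : I) : A →ₗ[k] k :=
  ψ ∘ₗ LinearMap.mulLeft k (G.p i)

/-- `ψ_{ij} = ψ(p_i · p_j)`. -/
noncomputable def component (G : GaloisObject k H A I) (ψ : A →ₗ[k] k) (i j : I) : A →ₗ[k] k :=
  ψ ∘ₗ LinearMap.mulRight k (G.p j) ∘ₗ LinearMap.mulLeft k (G.p i)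

/-- `ψ` is left complete if `ψ_{i-} ≠ 0` for all `i`. -/
def IsLeftComplete (G : GaloisObject k H A I) (ψ : A →ₗ[k] k) : Prop :=
  ∀ i : I, G.leftComponent ψ i ≠ 0

end GaloisObject

end GaloisCoaction

/-! Write `ν` for the right invariant functional on `H`. Uniqueness of `ν` up to scalars
(`IsRightInvariant.exists_eq_smul`) yields a group-like `g` with `h₁ ν(h₂) = ν(h) g`. Consequently
every `b₀ ν(b₁)` in `A` has weight `g`, meaning `α(w) = w ⊗ g`.

An invariant `ψ`, transported through the Galois map, becomes for each `i` an `A`-valued invariant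
on `H`, so it factors through `ν`. Thus `ψ_ij` is implemented by an element `x_ij ∈ p_j A p_i` of
weight `g⁻¹` (`exists_multiplier`, `exists_implementing`). If `ψ_ij ≠ 0`, then `x_ij` has an inverse
`w ∈ p_i A p_j` of weight `g` (`exists_inverse`).

A product of elements of weights `g` and `g⁻¹` is coinvariant. In a corner `p_j A p_m` it is
therefore `0` if `j ≠ m`, and a multiple of `p_j` if `j = m`. Multiplying by the invertible `x_ij`
and `w` turns this dichotomy into uniqueness of `j` for given `i`, bijectivity of `μ`, and
proportionality of components. -/

open Coalgebra

namespace GaloisCoaction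

/-- The slice map `id ⊗ ω : M ⊗ H → M`. -/
noncomputable def sliceRight {k H : Type*} (M : Type*) [Field k] [AddCommGroup H] [Module k H]
    [AddCommGroup M] [Module k M] (ω : H →ₗ[k] k) : M ⊗[k] H →ₗ[k] M :=
  (TensorProduct.rid k M).toLinearMap ∘ₗ ω.lTensor M

/-- The slice map `ω ⊗ id : M ⊗ H → H`. -/
noncomputable def sliceLeft {k M : Type*} (H : Type*) [Field k] [AddCommGroup H] [Module k H]
    [AddCommGroup M] [Module k M] (ω : M →ₗ[k] k) : M ⊗[k] H →ₗ[k] H :=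
  (TensorProduct.lid k H).toLinearMap ∘ₗ ω.rTensor H

section Slice

variable {k H M : Type*} [Field k] [AddCommGroup H] [Module k H] [AddCommGroup M] [Module k M]

@[simp]
theorem sliceRight_tmul (ω : H →ₗ[k] k) (m : M) (h : H) :
    sliceRight M ω (m ⊗ₜ[k] h) = ω h • m := by
  simp [sliceRight]

@[simp]
theorem sliceLeft_tmul (ω : M →ₗ[k] k) (m : M) (h : H) :
    sliceLeft H ω (m ⊗ₜ[k] h) = ω m • h := by
  simp [sliceLeft]

end Slice

/-! ### Uniqueness of invariant functionals on `H` and the modular element. -/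

section Hopf

variable {k H : Type*} [Field k] [Ring H] [HopfAlgebra k H]

/-- Left invariance of a functional on a Hopf algebra. -/
def IsLeftInvariant (φ : H →ₗ[k] k) : Prop :=
  ∀ h : H, sliceRight H φ (comul (R := k) h) = φ h • (1 : H)

/-- Right invariance of a functional on a Hopf algebra. -/
def IsRightInvariant (ψ : H →ₗ[k] k) : Prop :=
  ∀ h : H, sliceLeft H ψ (comul (R := k) h) = ψ h • (1 : H)

open HopfAlgebra WithConv in
/-- `(1 ⊗ n₁) Δ(S n₂) = S n ⊗ 1`. -/
theorem mul_comul_antipode (n : H) :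
    LinearMap.mul' k (H ⊗[k] H) (TensorProduct.map
      ((Algebra.TensorProduct.includeRight : H →ₐ[k] H ⊗[k] H) : H →ₗ[k] H ⊗[k] H)
      (comul ∘ₗ antipode k (A := H)) (comul (R := k) n)) = antipode k n ⊗ₜ[k] (1 : H) := by
  let i₁ : H →ₐ[k] H ⊗[k] H := Algebra.TensorProduct.includeLeft
  let i₂ : H →ₐ[k] H ⊗[k] H := Algebra.TensorProduct.includeRight
  have h₁ : toConv ((i₁ : H →ₗ[k] H ⊗[k] H) ∘ₗ antipode k (A := H)) *
      toConv (i₁ : H →ₗ[k] H ⊗[k] H) = 1 := by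
    ext c
    rw [(ℛ k c).convMul_apply]
    have := congrArg i₁ (sum_antipode_mul_eq_smul (ℛ k c))
    simp only [map_sum, map_mul, map_smul, map_one] at this
    simpa [Algebra.algebraMap_eq_smul_one] using this
  have h₂ : toConv (i₁ : H →ₗ[k] H ⊗[k] H) * toConv (i₂ : H →ₗ[k] H ⊗[k] H) =
      toConv (comul (R := k) (A := H)) := by
    ext c
    rw [(ℛ k c).convMul_apply]
    simp [i₁, i₂, (ℛ k c).eq]
  -- Insert `(i₁ ∘ S) * i₁ = 1` on the left; then `i₁ * i₂ = Δ` cancels against `Δ ∘ S`.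
  have h₃ : toConv (i₂ : H →ₗ[k] H ⊗[k] H) * toConv (comul ∘ₗ antipode k (A := H)) =
      toConv ((i₁ : H →ₗ[k] H ⊗[k] H) ∘ₗ antipode k (A := H)) := by
    rw [← one_mul (toConv (i₂ : H →ₗ[k] H ⊗[k] H)), ← h₁,
      mul_assoc _ (toConv (i₁ : H →ₗ[k] H ⊗[k] H)) (toConv (i₂ : H →ₗ[k] H ⊗[k] H)), h₂,
      mul_assoc, LinearMap.comul_right_inv, mul_one]
  exact congrArg (fun f => f n) h₃

/-- `n₁ ψ(S(n₂) x) = (ψ ⊗ id)((S n ⊗ 1) Δ x)` for a right invariant functional `ψ`. -/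
theorem IsRightInvariant.sliceRight_antipode {ψ : H →ₗ[k] k} (hψ : IsRightInvariant ψ) (n x : H) :
    sliceRight H (ψ ∘ₗ LinearMap.mulRight k x ∘ₗ HopfAlgebra.antipode k) (comul (R := k) n) =
      sliceLeft H ψ ((HopfAlgebra.antipode k n ⊗ₜ[k] (1 : H)) * comul (R := k) x) := by
  have key : ∀ u : H, ∀ t : H ⊗[k] H,
      sliceLeft H ψ (((1 : H) ⊗ₜ[k] u) * t) = u * sliceLeft H ψ t := by
    intro u t
    induction t with
    | zero => simp
    | add t₁ t₂ h₁ h₂ => simp [mul_add, h₁, h₂]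
    | tmul a b => simp
  rw [← mul_comul_antipode]
  generalize comul (R := k) n = t
  induction t with
  | zero => simp
  | add t₁ t₂ h₁ h₂ => simp only [map_add, h₁, h₂, add_mul]
  | tmul u v =>
    simp only [sliceRight_tmul, TensorProduct.map_tmul, LinearMap.mul'_apply,
      LinearMap.comp_apply, mul_assoc, ← Bialgebra.comul_mul]
    refine Eq.trans ?_ (key u _).symm
    rw [hψ]
    simp

/-- Faithfulness: `ψ(S(n) x) = 0` for all `x` forces `n = 0`. -/
theorem IsRightInvariant.eq_zero_of_antipode {ψ : H →ₗ[k] k} (hψ : IsRightInvariant ψ)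
    (hψ0 : ψ ≠ 0) {n : H} (hn : ∀ x, ψ (HopfAlgebra.antipode k n * x) = 0) : n = 0 := by
  let 𝓑 := Module.Basis.ofVectorSpace k H
  obtain ⟨c, hc⟩ := TensorProduct.eq_repr_basis_left 𝓑 (comul (R := k) n)
  -- The hypothesis on `n` passes to every right leg of `Δ n`, because `n₁ ψ(S(n₂) x) = 0` and the
  -- left legs are independent.
  have hw : ∀ i x, ψ (HopfAlgebra.antipode k (c i) * x) = 0 := by
    intro i x
    have h := hψ.sliceRight_antipode n x
    have h0 : sliceLeft H ψ ((HopfAlgebra.antipode k n ⊗ₜ[k] (1 : H)) * comul (R := k) x) = 0 := by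
      generalize comul (R := k) x = t
      induction t with
      | zero => simp
      | add t₁ t₂ h₁ h₂ => simp [mul_add, h₁, h₂]
      | tmul a b => simp [hn]
    rw [h0, ← hc, Finsupp.sum, map_sum] at h
    simp only [sliceRight_tmul] at h
    by_cases hi : i ∈ c.support
    · exact linearIndependent_iff'.1 𝓑.linearIndependent _ _ h i hi
    · simp [Finsupp.notMem_support_iff.1 hi]
  obtain ⟨x, hx⟩ := DFunLike.exists_ne hψ0
  let Z : H ⊗[k] (H ⊗[k] H) →ₗ[k] H ⊗[k] H :=
    (LinearMap.mul' k H ∘ₗ (HopfAlgebra.antipode k).rTensor H).lTensor H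
  let χ := sliceRight H (ψ ∘ₗ LinearMap.mulRight k x ∘ₗ HopfAlgebra.antipode k)
  have h1 : Z ((comul (R := k)).lTensor H (comul (R := k) n)) = n ⊗ₜ[k] (1 : H) := by
    have : Z ∘ₗ (comul (R := k)).lTensor H =
        (Algebra.linearMap k H ∘ₗ counit (R := k)).lTensor H := by
      rw [← HopfAlgebra.mul_antipode_rTensor_comul, ← LinearMap.lTensor_comp, LinearMap.comp_assoc]
    rw [← LinearMap.comp_apply, this, LinearMap.lTensor_comp, LinearMap.comp_apply,
      Coalgebra.lTensor_counit_comul]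
    simp
  have h2 : ∀ w, (∀ x, ψ (HopfAlgebra.antipode k w * x) = 0) → ∀ t : H ⊗[k] H,
      χ (Z (TensorProduct.assoc k H H H (t ⊗ₜ[k] w))) = 0 := by
    intro w hw t
    induction t with
    | zero => simp
    | add t₁ t₂ h₁ h₂ => simp only [TensorProduct.add_tmul, map_add, h₁, h₂, add_zero]
    | tmul u v => simp [χ, Z, HopfAlgebra.antipode_mul_antidistrib, mul_assoc, hw]
  -- Since `n ⊗ 1 = n₁ ⊗ S(n₂) n₃`, its image is `n₁ ψ(S(n₃) S²(n₂) x)`, where `S(n₃)` stands in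
  -- front and `hw` applies. Bijectivity of `S` is not needed.
  have h3 : χ (n ⊗ₜ[k] (1 : H)) = 0 := by
    rw [← h1, ← Coalgebra.coassoc_apply, ← hc, Finsupp.sum]
    simp only [map_sum, LinearMap.rTensor_tmul]
    exact Finset.sum_eq_zero fun i _ => h2 _ (hw i) _
  have hx' : ψ x ≠ 0 := hx
  simpa [χ, hx'] using h3

/-- `ψ(S n) φ(x) = ψ(S(φ(n₁) n₂) x)`. -/
theorem IsRightInvariant.antipode_mul_apply {φ ψ : H →ₗ[k] k} (hφ : IsLeftInvariant φ)
    (hψ : IsRightInvariant ψ) (n x : H) :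
    ψ (HopfAlgebra.antipode k (sliceLeft H φ (comul (R := k) n)) * x) =
      φ x * ψ (HopfAlgebra.antipode k n) := by
  have h := congrArg φ (hψ.sliceRight_antipode n x)
  have h1 : ∀ t : H ⊗[k] H,
      φ (sliceRight H (ψ ∘ₗ LinearMap.mulRight k x ∘ₗ HopfAlgebra.antipode k) t) =
        ψ (HopfAlgebra.antipode k (sliceLeft H φ t) * x) := by
    intro t
    induction t with
    | zero => simp
    | add t₁ t₂ h₁ h₂ => simp only [map_add, h₁, h₂, add_mul]
    | tmul u v => simp [mul_comm]
  have h2 : ∀ (y : H) (t : H ⊗[k] H),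
      φ (sliceLeft H ψ ((y ⊗ₜ[k] (1 : H)) * t)) = ψ (y * sliceRight H φ t) := by
    intro y t
    induction t with
    | zero => simp
    | add t₁ t₂ h₁ h₂ => simp only [map_add, h₁, h₂, mul_add]
    | tmul u v => simp [mul_comm]
  rw [← h1, h, h2, hφ x]
  simp

theorem counit_sliceLeft_comul (φ : H →ₗ[k] k) (n : H) :
    counit (R := k) (sliceLeft H φ (comul (R := k) n)) = φ n := by
  have h : ∀ t : H ⊗[k] H, counit (R := k) (sliceLeft H φ t) =
      φ (TensorProduct.rid k H ((counit (R := k)).lTensor H t)) := by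
    intro t
    induction t with
    | zero => simp
    | add t₁ t₂ h₁ h₂ => simp only [map_add, h₁, h₂]
    | tmul u v => simp [mul_comm]
  rw [h]
  simp

/-- Uniqueness of right invariant functionals. -/
theorem IsRightInvariant.exists_eq_smul {φ ψ χ : H →ₗ[k] k} (hφ : IsLeftInvariant φ) (hφ0 : φ ≠ 0)
    (hψ : IsRightInvariant ψ) (hψ0 : ψ ≠ 0) (hχ : IsRightInvariant χ) : ∃ c : k, χ = c • ψ := by
  -- If `ψ ∘ S = 0`, faithfulness kills every `φ(n₁) n₂`, and the counit then gives `φ = 0`.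
  obtain ⟨n, hn⟩ : ∃ n, ψ (HopfAlgebra.antipode k n) ≠ 0 := by
    by_contra! h
    refine hφ0 (LinearMap.ext fun n => ?_)
    rw [← counit_sliceLeft_comul, hψ.eq_zero_of_antipode hψ0
      (n := sliceLeft H φ (comul (R := k) n)) fun x => ?_]
    · simp
    · rw [antipode_mul_apply hφ hψ, h, mul_zero]
  -- With this `c`, `χ - c • ψ` vanishes at `S n`. Were it nonzero, its faithfulness would force
  -- `φ(n₁) n₂ = 0`, hence `φ = 0`.
  let c := χ (HopfAlgebra.antipode k n) / ψ (HopfAlgebra.antipode k n)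
  refine ⟨c, sub_eq_zero.1 ?_⟩
  by_contra h0 : χ - c • ψ ≠ 0
  have hinv : IsRightInvariant (χ - c • ψ) := by
    intro h
    have e : sliceLeft H (χ - c • ψ) = sliceLeft H χ - c • sliceLeft H ψ := by
      ext; simp [sub_smul, mul_smul]
    rw [e]
    simp [hχ h, hψ h, sub_smul, mul_smul]
  have hf : sliceLeft H φ (comul (R := k) n) = 0 := by
    refine hinv.eq_zero_of_antipode h0 fun x => ?_
    rw [antipode_mul_apply hφ hinv]
    simp [c, hn]
  refine hφ0 (LinearMap.ext fun x => ?_)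
  have := antipode_mul_apply hφ hψ n x
  rw [hf] at this
  simpa [hn] using this.symm

/-- The modular group-like element: `h₁ ψ(h₂) = ψ(h) g`. -/
theorem IsRightInvariant.exists_isGroupLikeElem {φ ψ : H →ₗ[k] k} (hφ : IsLeftInvariant φ)
    (hφ0 : φ ≠ 0) (hψ : IsRightInvariant ψ) (hψ0 : ψ ≠ 0) :
    ∃ g : H, IsGroupLikeElem k g ∧ ∀ h, sliceRight H ψ (comul (R := k) h) = ψ h • g := by
  obtain ⟨h₀, hh₀⟩ := DFunLike.exists_ne hψ0
  have hW : ∀ h, sliceRight H ψ (comul (R := k) h) =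
      ψ h • ((ψ h₀)⁻¹ • sliceRight H ψ (comul (R := k) h₀)) := by
    intro h
    rw [← sub_eq_zero, ← Module.forall_dual_apply_eq_zero_iff k]
    intro ω
    let χ : H →ₗ[k] k := ω ∘ₗ sliceRight H ψ ∘ₗ comul (R := k)
    -- By coassociativity `h ↦ ω(h₁) ψ(h₂)` is right invariant, hence a multiple of `ψ`.
    have hχ : IsRightInvariant χ := by
      intro h
      have e1 : ∀ t : H ⊗[k] H, sliceLeft H χ t = sliceLeft H ω ((sliceLeft H ψ).lTensor H
          (TensorProduct.assoc k H H H ((comul (R := k)).rTensor H t))) := by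
        intro t
        induction t with
        | zero => simp
        | add t₁ t₂ h₁ h₂ => simp only [map_add, h₁, h₂]
        | tmul u v =>
          simp only [χ, sliceLeft_tmul, LinearMap.rTensor_tmul, LinearMap.comp_apply]
          generalize comul (R := k) u = s
          induction s with
          | zero => simp
          | add t₁ t₂ h₁ h₂ => simp only [map_add, h₁, h₂, add_smul, TensorProduct.add_tmul]
          | tmul a b => simp [mul_smul]
      have e2 : ∀ t : H ⊗[k] H, sliceLeft H ω ((sliceLeft H ψ).lTensor H
          ((comul (R := k)).lTensor H t)) = ω (sliceRight H ψ t) • (1 : H) := by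
        intro t
        induction t with
        | zero => simp
        | add t₁ t₂ h₁ h₂ => simp only [map_add, h₁, h₂, add_smul]
        | tmul u v => simp [hψ v, smul_smul]
      rw [e1, Coalgebra.coassoc_apply, e2]
      rfl
    obtain ⟨c, hc⟩ := exists_eq_smul hφ hφ0 hψ hψ0 hχ
    have h1 : ω (sliceRight H ψ (comul (R := k) h)) = c * ψ h := by
      exact LinearMap.congr_fun hc h
    have h2 : ω (sliceRight H ψ (comul (R := k) h₀)) = c * ψ h₀ := by
      exact LinearMap.congr_fun hc h₀
    simp only [map_sub, map_smul, h1, h2, smul_eq_mul]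
    have : ψ h₀ ≠ 0 := hh₀
    field_simp
    ring
  set g := (ψ h₀)⁻¹ • sliceRight H ψ (comul (R := k) h₀) with hg
  refine ⟨g, ⟨?_, ?_⟩, hW⟩
  · have h1 : ∀ t : H ⊗[k] H, counit (R := k) (sliceRight H ψ t) =
        ψ (TensorProduct.lid k H ((counit (R := k)).rTensor H t)) := by
      intro t
      induction t with
      | zero => simp
      | add t₁ t₂ h₁ h₂ => simp only [map_add, h₁, h₂]
      | tmul u v => simp [mul_comm]
    have h2 := h1 (comul (R := k) h₀)
    rw [hW h₀] at h2
    have : ψ h₀ ≠ 0 := hh₀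
    simpa [this] using h2
  · have h1 : ∀ t : H ⊗[k] H, comul (R := k) (sliceRight H ψ t) =
        (sliceRight H ψ).lTensor H
          (TensorProduct.assoc k H H H ((comul (R := k)).rTensor H t)) := by
      intro t
      induction t with
      | zero => simp
      | add t₁ t₂ h₁ h₂ => simp only [map_add, h₁, h₂]
      | tmul u v =>
        simp only [sliceRight_tmul, LinearMap.rTensor_tmul, map_smul]
        generalize comul (R := k) u = s
        induction s with
        | zero => simp
        | add t₁ t₂ h₁ h₂ => simp only [map_add, h₁, h₂, smul_add, TensorProduct.add_tmul]
        | tmul a b => simp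
    have h2 : ∀ t : H ⊗[k] H, (sliceRight H ψ).lTensor H ((comul (R := k)).lTensor H t) =
        sliceRight H ψ t ⊗ₜ[k] g := by
      intro t
      induction t with
      | zero => simp
      | add t₁ t₂ h₁ h₂ => simp only [map_add, h₁, h₂, TensorProduct.add_tmul]
      | tmul u v => simp [hW v, TensorProduct.smul_tmul']
    have h3 := h1 (comul (R := k) h₀)
    rw [Coalgebra.coassoc_apply, h2, hW h₀, map_smul, ← TensorProduct.smul_tmul'] at h3
    have : ψ h₀ ≠ 0 := hh₀
    exact smul_right_injective _ this h3

end Hopf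


/-! ### Weights and slices in a Galois coaction. -/

section Coaction

variable {k H A : Type*} [Field k] [Ring H] [HopfAlgebra k H]
  [NonUnitalRing A] [Module k A] [IsScalarTower k A A] [SMulCommClass k A A]

/-- The action `a ↦ a₀ ω(a₁)` of a functional `ω` on `H`. -/
noncomputable def Coaction.slice (α : Coaction k H A) (ω : H →ₗ[k] k) : A →ₗ[k] A :=
  sliceRight A ω ∘ₗ (α.map : A →ₗ[k] A ⊗[k] H)

theorem sliceRight_tmul_one_mul (ω : H →ₗ[k] k) (c : A) (t : A ⊗[k] H) :
    sliceRight A ω ((c ⊗ₜ[k] (1 : H)) * t) = c * sliceRight A ω t := by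
  induction t with
  | zero => simp
  | add t₁ t₂ h₁ h₂ => simp only [map_add, h₁, h₂, mul_add]
  | tmul u v => simp [mul_smul_comm]

theorem sliceRight_mul_tmul_one (ω : H →ₗ[k] k) (c : A) (t : A ⊗[k] H) :
    sliceRight A ω (t * (c ⊗ₜ[k] (1 : H))) = sliceRight A ω t * c := by
  induction t with
  | zero => simp
  | add t₁ t₂ h₁ h₂ => simp only [map_add, h₁, h₂, add_mul]
  | tmul u v => simp [smul_mul_assoc]

namespace Coaction

variable (α : Coaction k H A)

theorem slice_apply (ω : H →ₗ[k] k) (a : A) : α.slice ω a = sliceRight A ω (α.map a) := rfl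

theorem slice_mul_right (ω : H →ₗ[k] k) {c : A} (hc : c ∈ α.coinvariants) (a : A) :
    α.slice ω (a * c) = α.slice ω a * c := by
  have hc' : α.map c = c ⊗ₜ[k] (1 : H) := hc
  rw [slice_apply, map_mul, hc', sliceRight_mul_tmul_one, slice_apply]

/-- Used with `g = 1` for a left invariant `ω`, where slices are coinvariant, and with the modular
element for a right invariant one. -/
theorem map_slice {ω : H →ₗ[k] k} {g : H}
    (hω : ∀ h, sliceRight H ω (comul (R := k) h) = ω h • g) (a : A) :
    α.map (α.slice ω a) = α.slice ω a ⊗ₜ[k] g := by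
  have h1 : ∀ t : A ⊗[k] H, α.map (sliceRight A ω t) = (sliceRight H ω).lTensor A
      (TensorProduct.assoc k A H H ((α.map : A →ₗ[k] A ⊗[k] H).rTensor H t)) := by
    intro t
    induction t with
    | zero => simp
    | add t₁ t₂ h₁ h₂ => simp only [map_add, h₁, h₂]
    | tmul u v =>
      simp only [sliceRight_tmul, LinearMap.rTensor_tmul, map_smul]
      change ω v • α.map u = (sliceRight H ω).lTensor A
        (TensorProduct.assoc k A H H (α.map u ⊗ₜ[k] v))
      generalize α.map u = s
      induction s with
      | zero => simp
      | add t₁ t₂ h₁ h₂ => simp only [map_add, h₁, h₂, smul_add, TensorProduct.add_tmul]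
      | tmul a b => simp
  have h2 : ∀ t : A ⊗[k] H, (sliceRight H ω).lTensor A ((comul (R := k)).lTensor A t) =
      sliceRight A ω t ⊗ₜ[k] g := by
    intro t
    induction t with
    | zero => simp
    | add t₁ t₂ h₁ h₂ => simp only [map_add, h₁, h₂, TensorProduct.add_tmul]
    | tmul u v => simp [hω v, TensorProduct.smul_tmul']
  rw [slice_apply, h1, α.coassoc, h2]

theorem mul_mem_coinvariants {x w : A} {g g' : H} (hg : g' * g = 1)
    (hx : α.map x = x ⊗ₜ[k] g') (hw : α.map w = w ⊗ₜ[k] g) : x * w ∈ α.coinvariants := by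
  change α.map (x * w) = _
  rw [map_mul, hx, hw, Algebra.TensorProduct.tmul_mul_tmul, hg]

variable {α}

theorem IsGalois.preGaloisMap_surjective (hα : α.IsGalois) :
    Function.Surjective α.preGaloisMap := by
  intro s
  obtain ⟨q, rfl⟩ := hα.2 s
  obtain ⟨t, rfl⟩ := Submodule.Quotient.mk_surjective _ q
  exact ⟨t, rfl⟩

/-- The elements `c a₀ ω(a₁)` span `A`. -/
theorem IsGalois.mem_span_mul_slice (hα : α.IsGalois) {ω : H →ₗ[k] k} (hω : ω ≠ 0) (y : A) :
    y ∈ Submodule.span k {z | ∃ c a, z = c * α.slice ω a} := by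
  obtain ⟨h, hh⟩ := DFunLike.exists_ne hω
  obtain ⟨t, ht⟩ := hα.preGaloisMap_surjective (y ⊗ₜ[k] ((ω h)⁻¹ • h))
  have hh' : ω h ≠ 0 := hh
  have hy : sliceRight A ω (α.preGaloisMap t) = y := by simp [ht, hh']
  rw [← hy]
  clear ht hy
  induction t with
  | zero => simp
  | add t₁ t₂ h₁ h₂ => simpa only [map_add] using add_mem h₁ h₂
  | tmul c a =>
    rw [preGaloisMap_tmul, sliceRight_tmul_one_mul]
    exact Submodule.subset_span ⟨c, a, rfl⟩

variable (α) in
-- Colinearity of the Galois map in its second leg; it transports invariance from `A` to `H`.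
theorem assoc_symm_comul_preGaloisMap (a b : A) :
    (TensorProduct.assoc k A H H).symm
        ((comul (R := k)).lTensor A (α.preGaloisMap (a ⊗ₜ[k] b))) =
      (α.preGaloisMap ∘ₗ TensorProduct.mk k A A a).rTensor H (α.map b) := by
  have h1 : ∀ t : A ⊗[k] H, (TensorProduct.assoc k A H H).symm
      ((comul (R := k)).lTensor A ((a ⊗ₜ[k] (1 : H)) * t)) =
      (LinearMap.mulLeft k (a ⊗ₜ[k] (1 : H))).rTensor H
        ((TensorProduct.assoc k A H H).symm ((comul (R := k)).lTensor A t)) := by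
    intro t
    induction t with
    | zero => simp
    | add t₁ t₂ h₁ h₂ => simp only [map_add, h₁, h₂, mul_add]
    | tmul u v =>
      simp only [Algebra.TensorProduct.tmul_mul_tmul, one_mul, LinearMap.lTensor_tmul]
      generalize comul (R := k) v = s
      induction s with
      | zero => simp
      | add t₁ t₂ h₁ h₂ => simp only [map_add, h₁, h₂, TensorProduct.tmul_add]
      | tmul x y => simp
  have h2 : α.preGaloisMap ∘ₗ TensorProduct.mk k A A a =
      LinearMap.mulLeft k (a ⊗ₜ[k] (1 : H)) ∘ₗ (α.map : A →ₗ[k] A ⊗[k] H) := by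
    ext b
    exact α.preGaloisMap_tmul a b
  rw [preGaloisMap_tmul, h1, ← α.coassoc, LinearEquiv.symm_apply_apply, h2, LinearMap.rTensor_comp,
    LinearMap.comp_apply]

end Coaction

end Coaction

/-! ### Corners of `A` and the elements implementing invariant functionals. -/

namespace GaloisObject

variable {k H A I : Type*} [Field k] [Ring H] [HopfAlgebra k H]
  [NonUnitalRing A] [Module k A] [IsScalarTower k A A] [SMulCommClass k A A]
  (G : GaloisObject k H A I)

theorem p_mem (i : I) : G.p i ∈ G.coinvariants := (G.iso (Finsupp.single i 1)).2

theorem map_p (i : I) : G.map (G.p i) = G.p i ⊗ₜ[k] (1 : H) := G.p_mem i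

theorem exists_iso_eq {b : A} (hb : b ∈ G.coinvariants) : ∃ f : I →₀ k, (G.iso f : A) = b := by
  obtain ⟨f, hf⟩ := G.iso_bijective.2 ⟨b, hb⟩
  exact ⟨f, congrArg Subtype.val hf⟩

theorem p_mul_iso (i : I) (f : I →₀ k) : G.p i * G.iso f = f i • G.p i := by
  have h : Finsupp.single i (1 : k) * f = f i • Finsupp.single i 1 := by
    classical
    ext j
    by_cases hj : i = j <;> simp [hj]
  have h' : G.iso (Finsupp.single i 1) * G.iso f = f i • G.iso (Finsupp.single i 1) := by
    rw [← map_mul, h, map_smul]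
  exact congrArg Subtype.val h'

theorem iso_mul_p (i : I) (f : I →₀ k) : G.iso f * G.p i = f i • G.p i := by
  have h : G.iso f * G.iso (Finsupp.single i 1) = G.iso (Finsupp.single i 1) * G.iso f := by
    rw [← map_mul, mul_comm, map_mul]
  exact (congrArg Subtype.val h).trans (G.p_mul_iso i f)

theorem p_mul_p_self (i : I) : G.p i * G.p i = G.p i := by
  exact (G.p_mul_iso i (Finsupp.single i 1)).trans (by simp)

theorem p_mul_p_of_ne {i j : I} (h : i ≠ j) : G.p i * G.p j = 0 := by
  exact (G.p_mul_iso i (Finsupp.single j 1)).trans (by simp [h])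

theorem p_ne_zero (i : I) : G.p i ≠ 0 := by
  intro h
  have : Finsupp.single i (1 : k) = 0 := G.iso_bijective.1 (Subtype.ext (h.trans (by simp)))
  simp at this

/-- A coinvariant element of `p_j A` is a multiple of `p_j`. -/
theorem exists_eq_smul_p {b : A} (hb : b ∈ G.coinvariants) {j : I} (hj : G.p j * b = b) :
    ∃ c : k, b = c • G.p j := by
  obtain ⟨f, rfl⟩ := G.exists_iso_eq hb
  exact ⟨f j, by rw [← G.p_mul_iso, hj]⟩

/-- A coinvariant element of `p_j A p_m` vanishes for `j ≠ m`. -/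
theorem eq_zero_of_corner {b : A} (hb : b ∈ G.coinvariants) {j m : I} (hjm : j ≠ m)
    (hj : G.p j * b = b) (hm : b * G.p m = b) : b = 0 := by
  obtain ⟨c, rfl⟩ := G.exists_eq_smul_p hb hj
  rw [← hm, smul_mul_assoc, G.p_mul_p_of_ne hjm, smul_zero]

/-- `A = ∑ A p_j`. -/
theorem mem_span_mul_p {φ : H →ₗ[k] k} (hφ : IsLeftInvariant φ) (hφ0 : φ ≠ 0) (y : A) :
    y ∈ Submodule.span k {z | ∃ c j, z = c * G.p j} := by
  refine Submodule.span_le.2 ?_ (G.isGalois.mem_span_mul_slice hφ0 y)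
  rintro _ ⟨c, a, rfl⟩
  obtain ⟨f, hf⟩ := G.exists_iso_eq (b := G.slice φ a) (G.map_slice hφ a)
  rw [← hf]
  clear hf
  induction f using Finsupp.induction_linear with
  | zero => simp
  | add f₁ f₂ h₁ h₂ =>
    rw [map_add, NonUnitalSubalgebra.coe_add, mul_add]
    exact add_mem h₁ h₂
  | single j r =>
    have : (G.iso (Finsupp.single j r) : A) = r • G.p j := by
      rw [← mul_one r, ← smul_eq_mul, ← Finsupp.smul_single, map_smul]
      simp [p]
    rw [this, mul_smul_comm]
    exact Submodule.smul_mem _ _ (Submodule.subset_span ⟨c, j, rfl⟩)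

/-- An invariant functional `ψ` gives rise to left `A`-linear maps `T_i` with
`T_i(a b₀ ν(b₁)) = ψ(p_i b) a p_i`. -/
theorem exists_multiplier {φ ν : H →ₗ[k] k} (hφ : IsLeftInvariant φ) (hφ0 : φ ≠ 0)
    (hν : IsRightInvariant ν) (hν0 : ν ≠ 0) {ψ : A →ₗ[k] k} (hψ : G.IsInvariant ψ) (i : I) :
    ∃ T : A →ₗ[k] A, (∀ c y, T (c * y) = c * T y) ∧
      ∀ a b, T (a * G.slice ν b) = ψ (G.p i * b) • (a * G.p i) := by
  let Φ₀ : A ⊗[k] A →ₗ[k] A := sliceRight A (ψ ∘ₗ LinearMap.mulLeft k (G.p i)) ∘ₗ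
    (LinearMap.mulRight k (G.p i)).rTensor A
  have hΦ₀ : ∀ a b, Φ₀ (a ⊗ₜ[k] b) = ψ (G.p i * b) • (a * G.p i) := fun a b => by simp [Φ₀]
  -- `Φ₀` is balanced because a coinvariant acts on `p_i` from either side by the same scalar.
  have hker : balancing G.coinvariants ≤ LinearMap.ker Φ₀ := by
    refine Submodule.span_le.2 ?_
    rintro _ ⟨a, b, hb, c, rfl⟩
    obtain ⟨f, rfl⟩ := G.exists_iso_eq hb
    simp only [SetLike.mem_coe, LinearMap.mem_ker, map_sub, hΦ₀]
    rw [mul_assoc, G.iso_mul_p, ← mul_assoc (G.p i), G.p_mul_iso, smul_mul_assoc, map_smul,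
      mul_smul_comm, smul_smul, smul_eq_mul, mul_comm, sub_self]
  let Γ := LinearEquiv.ofBijective G.galoisMap G.isGalois
  let Φ : A ⊗[k] H →ₗ[k] A := (balancing G.coinvariants).liftQ Φ₀ hker ∘ₗ Γ.symm.toLinearMap
  have hΦ : ∀ t, Φ (G.preGaloisMap t) = Φ₀ t := by
    intro t
    have h1 : Γ.symm (G.preGaloisMap t) = (balancing G.coinvariants).mkQ t :=
      Γ.symm_apply_eq.2 rfl
    change (balancing G.coinvariants).liftQ Φ₀ hker (Γ.symm (G.preGaloisMap t)) = _
    rw [h1]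
    rfl
  have hinv : ∀ (ω : A →ₗ[k] k) (s : A ⊗[k] H), sliceLeft H (ω ∘ₗ Φ)
      ((TensorProduct.assoc k A H H).symm ((comul (R := k)).lTensor A s)) =
      ω (Φ s) • (1 : H) := by
    intro ω s
    obtain ⟨t, rfl⟩ := G.isGalois.preGaloisMap_surjective s
    induction t with
    | zero => simp
    | add t₁ t₂ h₁ h₂ => simp only [map_add, h₁, h₂, add_smul]
    | tmul a b =>
      have h1 : ∀ t : A ⊗[k] H, sliceLeft H (ω ∘ₗ Φ)
          ((G.preGaloisMap ∘ₗ TensorProduct.mk k A A a).rTensor H t) =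
          ω (a * G.p i) • sliceLeft H ψ ((G.p i ⊗ₜ[k] (1 : H)) * t) := by
        intro t
        induction t with
        | zero => simp
        | add t₁ t₂ h₁ h₂ => simp only [map_add, h₁, h₂, mul_add, smul_add]
        | tmul u v => simp [hΦ, hΦ₀, smul_smul, mul_comm]
      have h2 : sliceLeft H ψ (G.map (G.p i * b)) = ψ (G.p i * b) • (1 : H) := hψ _
      rw [G.assoc_symm_comul_preGaloisMap, h1, ← G.map_p, ← map_mul, h2, hΦ, hΦ₀]
      simp [smul_smul, mul_comm]
  obtain ⟨h₀, hh₀⟩ := DFunLike.exists_ne hν0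
  have hh₀' : ν h₀ ≠ 0 := hh₀
  let T : A →ₗ[k] A := (ν h₀)⁻¹ • (Φ ∘ₗ (TensorProduct.mk k A H).flip h₀)
  -- For fixed `y` and `ω`, `h ↦ ω(Φ(y ⊗ h))` is right invariant, so uniqueness separates the
  -- variables.
  have hT : ∀ y h, Φ (y ⊗ₜ[k] h) = ν h • T y := by
    intro y h
    rw [← sub_eq_zero, ← Module.forall_dual_apply_eq_zero_iff k]
    intro ω
    have hχ : IsRightInvariant (ω ∘ₗ Φ ∘ₗ TensorProduct.mk k A H y) := by
      intro h
      have h1 : ∀ t : H ⊗[k] H, sliceLeft H (ω ∘ₗ Φ ∘ₗ TensorProduct.mk k A H y) t =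
          sliceLeft H (ω ∘ₗ Φ) ((TensorProduct.assoc k A H H).symm (y ⊗ₜ[k] t)) := by
        intro t
        induction t with
        | zero => simp
        | add t₁ t₂ h₁ h₂ => simp only [map_add, h₁, h₂, TensorProduct.tmul_add]
        | tmul u v => simp
      rw [h1]
      exact hinv ω (y ⊗ₜ[k] h)
    obtain ⟨c, hc⟩ := hν.exists_eq_smul hφ hφ0 hν0 hχ
    have e : ∀ h, ω (Φ (y ⊗ₜ[k] h)) = c * ν h := fun h => LinearMap.congr_fun hc h
    simp only [map_sub, map_smul, T, LinearMap.smul_apply, LinearMap.comp_apply,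
      LinearMap.flip_apply, TensorProduct.mk_apply, e, smul_eq_mul]
    field_simp
    ring
  have hTs : ∀ s, Φ s = T (sliceRight A ν s) := by
    intro s
    induction s with
    | zero => simp
    | add t₁ t₂ h₁ h₂ => simp only [map_add, h₁, h₂]
    | tmul y h => simp [hT]
  have hTm : ∀ a b, T (a * G.slice ν b) = ψ (G.p i * b) • (a * G.p i) := by
    intro a b
    rw [← hΦ₀, ← hΦ, hTs, Coaction.preGaloisMap_tmul, sliceRight_tmul_one_mul]
    rfl
  refine ⟨T, fun c y => ?_, hTm⟩
  induction G.isGalois.mem_span_mul_slice hν0 y using Submodule.span_induction with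
  | mem x hx =>
    obtain ⟨a, b, rfl⟩ := hx
    rw [← mul_assoc, hTm, hTm, mul_smul_comm, mul_assoc]
  | zero => simp
  | add x y _ _ hx hy => simp only [mul_add, map_add, hx, hy]
  | smul r x _ hx => simp only [mul_smul_comm, map_smul, hx]

/-- The elements `x_{ij} ∈ p_j A p_i` implementing the components of an invariant functional. -/
theorem exists_implementing {φ ν : H →ₗ[k] k} (hφ : IsLeftInvariant φ) (hφ0 : φ ≠ 0)
    (hν : IsRightInvariant ν) (hν0 : ν ≠ 0) {g g' : H} (hg : g * g' = 1)
    (hνg : ∀ h, sliceRight H ν (comul (R := k) h) = ν h • g)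
    {ψ : A →ₗ[k] k} (hψ : G.IsInvariant ψ) (i j : I) :
    ∃ x : A, G.p j * x = x ∧ x * G.p i = x ∧ G.map x = x ⊗ₜ[k] g' ∧
      ∀ b, G.p i * G.slice ν b * x = G.component ψ i j b • G.p i := by
  obtain ⟨T, hT, hTm⟩ := G.exists_multiplier hφ hφ0 hν hν0 hψ i
  have hspan := G.isGalois.mem_span_mul_slice hν0
  have hTp : ∀ y, T y * G.p i = T y := by
    intro y
    induction hspan y using Submodule.span_induction with
    | mem x hx =>
      obtain ⟨a, b, rfl⟩ := hx
      rw [hTm, smul_mul_assoc, mul_assoc, G.p_mul_p_self]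
    | zero => simp
    | add x y _ _ hx hy => simp only [add_mul, map_add, hx, hy]
    | smul r x _ hx => simp only [smul_mul_assoc, map_smul, hx]
  -- `T` lowers weight by `g`; at the coinvariant `p_j` this gives `T(p_j)` weight `g'`.
  have hTα : ∀ y, (LinearMap.mulRight k g).lTensor A (G.map (T y)) = T.rTensor H (G.map y) := by
    intro y
    induction hspan y using Submodule.span_induction with
    | mem x hx =>
      obtain ⟨a, b, rfl⟩ := hx
      rw [hTm, map_smul, map_mul G.map, map_mul G.map, G.map_slice hνg, G.map_p]
      generalize G.map a = s
      induction s with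
      | zero => simp
      | add t₁ t₂ h₁ h₂ => simp only [add_mul, map_add, smul_add, ← h₁, ← h₂]
      | tmul u v => simp [hTm, TensorProduct.smul_tmul']
    | zero => simp
    | add x y _ _ hx hy => simp only [map_add, hx, hy]
    | smul r x _ hx => simp only [map_smul, hx]
  refine ⟨T (G.p j), by rw [← hT, G.p_mul_p_self], hTp _, ?_, fun b => ?_⟩
  · have h := congrArg ((LinearMap.mulRight k g').lTensor A) (hTα (G.p j))
    have e : LinearMap.mulRight k g' ∘ₗ LinearMap.mulRight k g = LinearMap.id := by
      ext h
      simp [mul_assoc, hg]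
    rw [← LinearMap.comp_apply, ← LinearMap.lTensor_comp, e, G.map_p] at h
    simpa using h
  · rw [← hT, mul_assoc, ← G.slice_mul_right ν (G.p_mem j), hTm, G.p_mul_p_self, ← mul_assoc]
    rfl

/-- Nonzero components are implemented by invertible elements of `p_j A p_i`. -/
theorem exists_inverse {ν : H →ₗ[k] k} {g g' : H} (hg : g' * g = 1)
    (hνg : ∀ h, sliceRight H ν (comul (R := k) h) = ν h • g) {ψ : A →ₗ[k] k} {i j : I} {x : A}
    (hjx : G.p j * x = x) (hxi : x * G.p i = x) (hx : G.map x = x ⊗ₜ[k] g')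
    (hxψ : ∀ b, G.p i * G.slice ν b * x = G.component ψ i j b • G.p i)
    (h0 : G.component ψ i j ≠ 0) :
    ∃ w : A, G.p i * w = w ∧ w * G.p j = w ∧ G.map w = w ⊗ₜ[k] g ∧
      w * x = G.p i ∧ x * w = G.p j := by
  obtain ⟨b, hb⟩ := DFunLike.exists_ne h0
  have hb' : G.component ψ i j b ≠ 0 := hb
  let w := (G.component ψ i j b)⁻¹ • (G.p i * G.slice ν b * G.p j)
  have hiw : G.p i * w = w := by simp [w, mul_smul_comm, ← mul_assoc, G.p_mul_p_self]
  have hwj : w * G.p j = w := by simp [w, smul_mul_assoc, mul_assoc, G.p_mul_p_self]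
  have hw : G.map w = w ⊗ₜ[k] g := by
    simp [w, G.map_p, G.map_slice hνg, TensorProduct.smul_tmul']
  have hwx : w * x = G.p i := by
    simp only [w, smul_mul_assoc]
    rw [mul_assoc _ (G.p j), hjx, hxψ, smul_smul, inv_mul_cancel₀ hb', one_smul]
  refine ⟨w, hiw, hwj, hw, hwx, ?_⟩
  -- `x w` is coinvariant, so it equals `c p_j`; then `x = x w x = c x` forces `c = 1`.
  obtain ⟨c, hc⟩ := G.exists_eq_smul_p (G.mul_mem_coinvariants hg hx hw) (j := j)
    (by rw [← mul_assoc, hjx])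
  have h1 : x = c • x := by
    calc x = x * w * x := by rw [mul_assoc, hwx, hxi]
      _ = c • x := by rw [hc, smul_mul_assoc, hjx]
  have hx0 : x ≠ 0 := by
    rintro rfl
    exact G.p_ne_zero i (by rw [← hwx, mul_zero])
  have h2 : c = 1 := by
    by_contra hne
    have : (c - 1) • x = 0 := by rw [sub_smul, one_smul, ← h1, sub_self]
    exact (smul_ne_zero (sub_ne_zero.2 hne) hx0) this
  rw [hc, h2, one_smul]

end GaloisObject

end GaloisCoaction

/-! ### Assembling the bijection and the scalars. -/

open GaloisCoaction in
theorem mainTheorem10 {k H A I : Type*} [Field k] [Ring H] [HopfAlgebra k H]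
    [NonUnitalRing A] [Module k A] [IsScalarTower k A A] [SMulCommClass k A A]
    (hH : GaloisCoaction.HasInvariantFunctionals k H)
    (G : GaloisCoaction.GaloisObject k H A I)
    (ψ : A →ₗ[k] k) (hψ : G.IsInvariant ψ) (hψc : G.IsLeftComplete ψ) :
    ∃ μ : I ≃ I,
      (∀ i j : I, G.component ψ i j ≠ 0 ↔ j = μ i) ∧
      ∀ ψ' : A →ₗ[k] k, G.IsInvariant ψ' →
        ∃ c : I → k,
          (∀ i : I, G.component ψ' i (μ i) = c i • G.component ψ i (μ i)) ∧
          (∀ i j : I, j ≠ μ i → G.component ψ' i j = 0) := by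
  obtain ⟨⟨φ, hφ0, hφ⟩, ν, hν0, hν⟩ := hH
  replace hφ : IsLeftInvariant φ := hφ
  replace hν : IsRightInvariant ν := hν
  obtain ⟨g, hgl, hνg⟩ := hν.exists_isGroupLikeElem hφ hφ0 hν0
  let g' := HopfAlgebra.antipode k g
  have hgg' : g * g' = 1 := hgl.mul_antipode_cancel
  have hg'g : g' * g = 1 := hgl.antipode_mul_cancel
  have hmem (a : A) := G.mem_span_mul_p hφ hφ0 a
  choose x hjx hxi hx hxψ using G.exists_implementing hφ hφ0 hν hν0 hgg' hνg hψ
  have hinv (i j : I) (h : G.component ψ i j ≠ 0) :=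
    G.exists_inverse hg'g hνg (hjx i j) (hxi i j) (hx i j) (hxψ i j) h
  -- Left completeness gives `ψ(p_i ·) ≠ 0`, and `A = ∑ A p_j` isolates some `j`.
  have hex : ∀ i, ∃ j, G.component ψ i j ≠ 0 := by
    intro i
    by_contra! h
    refine hψc i (LinearMap.ext fun a => ?_)
    induction hmem a using Submodule.span_induction with
    | mem z hz =>
      obtain ⟨c, j, rfl⟩ := hz
      simpa [GaloisObject.component, GaloisObject.leftComponent, mul_assoc] using
        LinearMap.congr_fun (h j) c
    | zero => simp
    | add y z _ _ hy hz => simp only [map_add, hy, hz]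
    | smul r y _ hy => simp [hy]
  choose m hm using hex
  choose w hiw hwj hw hwx hxw using fun i => hinv i (m i) (hm i)
  have hker : ∀ (ψ' : A →ₗ[k] k) (i j : I) (y : A),
      (∀ b, G.p i * G.slice ν b * y = G.component ψ' i j b • G.p i) → y = 0 →
        G.component ψ' i j = 0 := by
    rintro ψ' i j y hy rfl
    ext b
    simpa [G.p_ne_zero i] using (hy b).symm
  have huniq : ∀ ψ' : A →ₗ[k] k, G.IsInvariant ψ' → ∀ i j, j ≠ m i → G.component ψ' i j = 0 := by
    intro ψ' hψ' i j hj
    obtain ⟨y, hjy, hyi, hy, hyψ⟩ := G.exists_implementing hφ hφ0 hν hν0 hgg' hνg hψ' i j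
    refine hker ψ' i j y hyψ ?_
    have h0 : y * w i = 0 := G.eq_zero_of_corner (G.mul_mem_coinvariants hg'g hy (hw i)) hj
      (by rw [← mul_assoc, hjy]) (by rw [mul_assoc, hwj])
    rw [← hyi, ← hwx i, ← mul_assoc, h0, zero_mul]
  have hinj : Function.Injective m := by
    intro i l hil
    by_contra hne
    have h0 : w i * x l (m l) = 0 := G.eq_zero_of_corner
      (G.mul_mem_coinvariants hgg' (hw i) (hx l (m l))) hne
      (by rw [← mul_assoc, hiw]) (by rw [mul_assoc, hxi])
    have h1 : x l (m l) = 0 := by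
      rw [← hjx l (m l), ← hil, ← hxw i, mul_assoc, hil, h0, mul_zero]
    exact G.p_ne_zero l (by rw [← hwx l, h1, mul_zero])
  have hsurj : Function.Surjective m := by
    intro j
    -- Otherwise `A p_j = 0`, contradicting `p_j ≠ 0`. This nonzero element of weight `g` can only
    -- lie in `p_i A p_(m i)`, so `m i = j`.
    obtain ⟨i, b, hib⟩ : ∃ i b, G.p i * G.slice ν b * G.p j ≠ 0 := by
      by_contra! h
      have h1 : ∀ c b, c * (G.slice ν b * G.p j) = 0 := by
        intro c b
        induction hmem c using Submodule.span_induction with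
        | mem z hz =>
          obtain ⟨c, i, rfl⟩ := hz
          rw [mul_assoc, ← mul_assoc (G.p i), h, mul_zero]
        | zero => simp
        | add y z _ _ hy hz => rw [add_mul, hy, hz, add_zero]
        | smul r y _ hy => rw [smul_mul_assoc, hy, smul_zero]
      have h2 : ∀ y, y * G.p j = 0 := by
        intro y
        induction G.isGalois.mem_span_mul_slice hν0 y using Submodule.span_induction with
        | mem z hz =>
          obtain ⟨c, b, rfl⟩ := hz
          rw [mul_assoc, h1]
        | zero => simp
        | add y z _ _ hy hz => rw [add_mul, hy, hz, add_zero]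
        | smul r y _ hy => rw [smul_mul_assoc, hy, smul_zero]
      exact G.p_ne_zero j (by rw [← G.p_mul_p_self, h2])
    refine ⟨i, ?_⟩
    by_contra hne
    set v := G.p i * G.slice ν b * G.p j
    have hv : G.map v = v ⊗ₜ[k] g := by simp [v, G.map_p, G.map_slice hνg]
    have hiv : G.p i * v = v := by simp [v, ← mul_assoc, G.p_mul_p_self]
    have h0 : x i (m i) * v = 0 := G.eq_zero_of_corner
      (G.mul_mem_coinvariants hg'g (hx i (m i)) hv) hne
      (by rw [← mul_assoc, hjx]) (by simp [v, mul_assoc, G.p_mul_p_self])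
    exact hib (by rw [← hiv, ← hwx i, mul_assoc, h0, mul_zero])
  refine ⟨Equiv.ofBijective m ⟨hinj, hsurj⟩, fun i j => ⟨fun h => ?_, ?_⟩, fun ψ' hψ' => ?_⟩
  · by_contra hj
    exact h (huniq ψ hψ i j hj)
  · rintro rfl
    exact hm i
  · have hc : ∀ i, ∃ c : k, G.component ψ' i (m i) = c • G.component ψ i (m i) := by
      intro i
      obtain ⟨y, hjy, hyi, hy, hyψ⟩ := G.exists_implementing hφ hφ0 hν hν0 hgg' hνg hψ' i (m i)
      obtain ⟨c, hc⟩ := G.exists_eq_smul_p (G.mul_mem_coinvariants hg'g hy (hw i)) (j := m i)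
        (by rw [← mul_assoc, hjy])
      have hyx : y = c • x i (m i) := by
        rw [← hyi, ← hwx i, ← mul_assoc, hc, smul_mul_assoc, hjx]
      refine ⟨c, LinearMap.ext fun b => ?_⟩
      have h := hyψ b
      rw [hyx, mul_smul_comm, hxψ, smul_smul] at h
      exact (smul_left_injective k (G.p_ne_zero i) h).symm
    choose c hc using hc
    exact ⟨c, hc, huniq ψ' hψ'⟩
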